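/- Let $p\ge 5$, $2\le r\le p-3$, $k\ge 0$, and let $0<\tau_1<\dots<\tau_k<1$. Let $\mathcal S$ be the space of univariate splines on $[0,1]$ of degree $p$ with inner knots $\tau_1,\dots,\tau_k$, each of multiplicity $p-r$ (that is, functions which are a polynomial of degree at most $p$ on each knot span and are $C^r$ on $[0,1]$), and let $\mathcal S_2=\mathcal S\otimes\mathcal S$ be the tensor-product spline space on $[0,1]^2$. Let $\mathbf F^{(L)},\mathbf F^{(R)}\in\mathcal S_2\times\mathcal S_2$ be two injective mappings $[0,1]^2\to\mathbb R^2$ whose Jacobian determinant vanishes nowhere on $[0,1]^2$. Put $\Omega^{(S)}=\mathbf F^{(S)}([0,1]^2)$ for $S\in\{L,R\}$ and $\Omega=\Omega^{(L)}\cup\Omega^{(R)}$, and assume that $\mathbf F_0(v):=\mathbf F^{(L)}(0,v)=\mathbf F^{(R)}(0,v)$ for all $v\in[0,1]$ and that $\Omega^{(L)}\cap\Omega^{(R)}=\mathbf F_0([0,1])$. All derivatives are one-sided at the boundary of $[0,1]$ and $[0,1]^2$. Assume that this two-patch parameterization is bilinear-like $G^2$ with polynomials $\alpha^{(L)},\alpha^{(R)},\beta^{(L)},\beta^{(R)}$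 of degree at most $1$, which means that, with $$\beta=\alpha^{(L)}\beta^{(R)}-\alpha^{(R)}\beta^{(L)},\qquad \eta=2(\alpha^{(L)})'\alpha^{(R)}\beta,\qquad \theta=2\bigl(\alpha^{(L)}(\beta^{(L)})'-(\alpha^{(L)})'\beta^{(L)}\bigr)\alpha^{(R)}\beta,$$ $$\mathbf Z(v)=(\alpha^{(L)}(v))^2D_{uu}\mathbf F^{(R)}(0,v)-\Bigl((\alpha^{(R)}(v))^2D_{uu}\mathbf F^{(L)}(0,v)+2\alpha^{(R)}(v)\beta(v)D_{uv}\mathbf F^{(L)}(0,v)+\beta(v)^2\mathbf F_0''(v)\Bigr),$$ one has for all $v\in[0,1]$: $\alpha^{(L)}(v)\alpha^{(R)}(v)<0$, $$\alpha^{(R)}(v)D_u\mathbf F^{(L)}(0,v)-\alpha^{(L)}(v)D_u\mathbf F^{(R)}(0,v)+\beta(v)D_v\mathbf F^{(L)}(0,v)=\mathbf 0,$$ $$\alpha^{(L)}(v)\mathbf Z(v)+\eta(v)D_u\mathbf F^{(L)}(0,v)+\theta(v)D_v\mathbf F^{(L)}(0,v)=\mathbf 0.$$ Let $\phi:\Omega\to\mathbb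 R$ be an isogeometric function, i.e. $g^{(S)}:=\phi\circ\mathbf F^{(S)}\in\mathcal S_2$ for $S\in\{L,R\}$. Then $\phi\in C^2(\Omega)$ if and only if for all $v\in[0,1]$ $$g^{(L)}(0,v)=g^{(R)}(0,v),$$ $$\frac{D_ug^{(L)}(0,v)-\beta^{(L)}(v)g_0'(v)}{\alpha^{(L)}(v)}=\frac{D_ug^{(R)}(0,v)-\beta^{(R)}(v)g_0'(v)}{\alpha^{(R)}(v)},$$ $$\frac{D_{uu}g^{(L)}(0,v)-(\beta^{(L)}(v))^2g_0''(v)-2\alpha^{(L)}(v)\beta^{(L)}(v)g_1'(v)}{(\alpha^{(L)}(v))^2}=\frac{D_{uu}g^{(R)}(0,v)-(\beta^{(R)}(v))^2g_0''(v)-2\alpha^{(R)}(v)\beta^{(R)}(v)g_1'(v)}{(\alpha^{(R)}(v))^2},$$ where $g_0$ and $g_1$ denote the functions on $[0,1]$ given by the common values of the two sides of the first and of the second equation, respectively. -/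

import Mathlib

open Set Polynomial

noncomputable section

namespace TwoPatch

/-- The labels `L` and `R` of the two patches. -/
inductive Side
  | L
  | R

/-- The parameter interval `[0,1]`. -/
def unitI : Set ℝ := Icc 0 1

/-- The parameter square `[0,1]²`; points are written `(u, v)`. -/
def unitSq : Set (ℝ × ℝ) := unitI ×ˢ unitI

/-! ### Derivatives on `[0,1]` and `[0,1]²` (one-sided at the boundary) -/

section Derivatives

variable {E : Type*} [NormedAddCommGroup E] [NormedSpace ℝ E]

/-- Derivative of a function on `[0,1]`, one-sided at the end points. -/
def dI (f : ℝ → E) (t : ℝ) : E := derivWithin f unitI t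

/-- Partial derivative `D_u` of a function on `[0,1]²`. -/
def dU (G : ℝ × ℝ → E) (x : ℝ × ℝ) : E := dI (fun s => G (s, x.2)) x.1

/-- Partial derivative `D_v` of a function on `[0,1]²`. -/
def dV (G : ℝ × ℝ → E) (x : ℝ × ℝ) : E := dI (fun t => G (x.1, t)) x.2

end Derivatives

/-! ### Spline spaces -/

/-- `τ₁ < … < τ_k` are inner knots: they all lie strictly between `0` and `1`. -/
def IsInnerKnots {k : ℕ} (τ : Fin k → ℝ) : Prop :=
  StrictMono τ ∧ ∀ i, τ i ∈ Ioo (0 : ℝ) 1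

/-- The break points `0, τ₁, …, τ_k, 1`. -/
def breakPoint {k : ℕ} (τ : Fin k → ℝ) : Fin (k + 2) → ℝ :=
  Fin.cons 0 (Fin.snoc τ 1)

/-- The univariate spline space of degree `p` on `[0,1]` for the open knot vector with inner knots
`τ₁, …, τ_k`, each of multiplicity `p - r`: the functions that are a polynomial of degree at most
`p` on every knot span and are `r` times continuously differentiable on `[0,1]`. Membership
depends only on the values on `[0,1]`. -/
def splineSpace (p r : ℕ) {k : ℕ} (τ : Fin k → ℝ) : Set (ℝ → ℝ) :=
  {f | ContDiffOn ℝ r f unitI ∧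
    ∀ i : Fin (k + 1), ∃ P : ℝ[X], P.natDegree ≤ p ∧
      ∀ x ∈ Icc (breakPoint τ i.castSucc) (breakPoint τ i.succ), f x = P.eval x}

/-- The tensor-product spline space of bidegree `(p, p)` on `[0,1]²`: finite sums of products
`a(u) b(v)` of univariate splines. Membership depends only on the values on `[0,1]²`. -/
def splineSpace₂ (p r : ℕ) {k : ℕ} (τ : Fin k → ℝ) : Set (ℝ × ℝ → ℝ) :=
  {g | ∃ (n : ℕ) (a b : Fin n → ℝ → ℝ),
    (∀ i, a i ∈ splineSpace p r τ) ∧ (∀ i, b i ∈ splineSpace p r τ) ∧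
      ∀ u ∈ unitI, ∀ v ∈ unitI, g (u, v) = ∑ i, a i u * b i v}

/-! ### Two-patch parameterizations -/

/-- `det[a, b]` for `a, b ∈ ℝ²`. -/
def det₂ (a b : ℝ × ℝ) : ℝ := a.1 * b.2 - a.2 * b.1

/-- The patch `Ω^(S) = F^(S)([0,1]²)`. -/
def patch (F : Side → ℝ × ℝ → ℝ × ℝ) (S : Side) : Set (ℝ × ℝ) := F S '' unitSq

/-- The two-patch domain `Ω = Ω^(L) ∪ Ω^(R)`. -/
def domain (F : Side → ℝ × ℝ → ℝ × ℝ) : Set (ℝ × ℝ) := patch F Side.L ∪ patch F Side.R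

/-- The parameterization `F₀(v) = F^(L)(0, v)` of the interface. -/
def interfaceCurve (F : Side → ℝ × ℝ → ℝ × ℝ) (v : ℝ) : ℝ × ℝ := F Side.L (0, v)

/-- `F` consists of two regular geometry mappings with spline coordinates, each of them bijective
onto its patch, and the two patches meet exactly in the common edge `u = 0`. -/
structure IsTwoPatchParameterization (p r : ℕ) {k : ℕ} (τ : Fin k → ℝ)
    (F : Side → ℝ × ℝ → ℝ × ℝ) : Prop where
  spline_fst : ∀ S, (fun x => (F S x).1) ∈ splineSpace₂ p r τ
  spline_snd : ∀ S, (fun x => (F S x).2) ∈ splineSpace₂ p r τ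
  regular : ∀ S, ∀ x ∈ unitSq, det₂ (dU (F S) x) (dV (F S) x) ≠ 0
  injective : ∀ S, InjOn (F S) unitSq
  edge_eq : ∀ v ∈ unitI, F Side.L (0, v) = F Side.R (0, v)
  inter_eq : patch F Side.L ∩ patch F Side.R = interfaceCurve F '' unitI

/-! ### Isogeometric functions -/

/-- The space `𝒱` of isogeometric functions `φ : Ω → ℝ`: the function `φ ∘ F^(S)` is a
tensor-product spline for both `S`. A function on `Ω` is given as a function on `ℝ²` of which only
the values on `Ω` matter. -/
def isogeometricSpace (p r : ℕ) {k : ℕ} (τ : Fin k → ℝ) (F : Side → ℝ × ℝ → ℝ × ℝ) :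
    Set (ℝ × ℝ → ℝ) :=
  {φ | ∀ S, φ ∘ F S ∈ splineSpace₂ p r τ}

/-- The space `𝒱^s = 𝒱 ∩ C^s(Ω)` of globally `C^s`-smooth isogeometric functions. -/
def smoothIsogeometricSpace (p r : ℕ) {k : ℕ} (τ : Fin k → ℝ) (F : Side → ℝ × ℝ → ℝ × ℝ)
    (s : ℕ) : Set (ℝ × ℝ → ℝ) :=
  isogeometricSpace p r τ F ∩ {φ | ContDiffOn ℝ s φ (domain F)}

/-! ### Bilinear-like `G²` parameterizations -/

/-- `β = α^(L) β^(R) - α^(R) β^(L)`. -/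
def gluingBeta (α β : Side → ℝ[X]) (v : ℝ) : ℝ :=
  (α Side.L).eval v * (β Side.R).eval v - (α Side.R).eval v * (β Side.L).eval v

/-- `Z = (α^(L))² D_uu F^(R) - ((α^(R))² D_uu F^(L) + 2 α^(R) β D_uv F^(L) + β² F₀'')` on the
interface. -/
def gluingZ (F : Side → ℝ × ℝ → ℝ × ℝ) (α β : Side → ℝ[X]) (v : ℝ) : ℝ × ℝ :=
  ((α Side.L).eval v) ^ 2 • dU (dU (F Side.R)) (0, v)
    - (((α Side.R).eval v) ^ 2 • dU (dU (F Side.L)) (0, v)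
      + (2 * (α Side.R).eval v * gluingBeta α β v) • dV (dU (F Side.L)) (0, v)
      + (gluingBeta α β v) ^ 2 • dI (dI (interfaceCurve F)) v)

/-- `η = 2 (α^(L))' α^(R) β`. -/
def gluingEta (α β : Side → ℝ[X]) (v : ℝ) : ℝ :=
  2 * (derivative (α Side.L)).eval v * (α Side.R).eval v * gluingBeta α β v

/-- `θ = 2 (α^(L) (β^(L))' - (α^(L))' β^(L)) α^(R) β`. -/
def gluingTheta (α β : Side → ℝ[X]) (v : ℝ) : ℝ :=
  2 * ((α Side.L).eval v * (derivative (β Side.L)).eval v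
    - (derivative (α Side.L)).eval v * (β Side.L).eval v)
    * (α Side.R).eval v * gluingBeta α β v

/-- The two-patch parameterization `F` is bilinear-like `G²` with the functions
`α^(L), α^(R), β^(L), β^(R)`, which are polynomials of degree at most `1`. The sign condition
excludes trivial choices such as `α^(L) = α^(R) = 0`. -/
structure IsBilinearLikeG2With (F : Side → ℝ × ℝ → ℝ × ℝ) (α β : Side → ℝ[X]) : Prop where
  natDegree_alpha : ∀ S, (α S).natDegree ≤ 1
  natDegree_beta : ∀ S, (β S).natDegree ≤ 1
  alpha_mul_neg : ∀ v ∈ unitI, (α Side.L).eval v * (α Side.R).eval v < 0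
  edge_eq : ∀ v ∈ unitI, F Side.L (0, v) = F Side.R (0, v)
  first_order : ∀ v ∈ unitI,
    (α Side.R).eval v • dU (F Side.L) (0, v) - (α Side.L).eval v • dU (F Side.R) (0, v)
      + gluingBeta α β v • dV (F Side.L) (0, v) = 0
  second_order : ∀ v ∈ unitI,
    (α Side.L).eval v • gluingZ F α β v + gluingEta α β v • dU (F Side.L) (0, v)
      + gluingTheta α β v • dV (F Side.L) (0, v) = 0

/-! ### Interface quantities of an isogeometric function

Each is computed from one side `S`, for `g^(S) = φ ∘ F^(S)`; where the values from the two sides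
agree on `[0,1]`, so do the derivatives that enter the next quantity. -/

/-- `g₀(v) = g^(S)(0, v)`. -/
def gZero (F : Side → ℝ × ℝ → ℝ × ℝ) (φ : ℝ × ℝ → ℝ) (S : Side) (v : ℝ) : ℝ :=
  (φ ∘ F S) (0, v)

/-- `g₁(v) = (D_u g^(S)(0, v) - β^(S)(v) g₀'(v)) / α^(S)(v)`. -/
def gOne (F : Side → ℝ × ℝ → ℝ × ℝ) (α β : Side → ℝ[X]) (φ : ℝ × ℝ → ℝ) (S : Side) (v : ℝ) : ℝ :=
  (dU (φ ∘ F S) (0, v) - (β S).eval v * dI (gZero F φ S) v) / (α S).eval v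

/-- `g₂(v) = (D_uu g^(S)(0, v) - (β^(S)(v))² g₀''(v) - 2 α^(S)(v) β^(S)(v) g₁'(v)) / (α^(S)(v))²`. -/
def gTwo (F : Side → ℝ × ℝ → ℝ × ℝ) (α β : Side → ℝ[X]) (φ : ℝ × ℝ → ℝ) (S : Side) (v : ℝ) : ℝ :=
  (dU (dU (φ ∘ F S)) (0, v) - ((β S).eval v) ^ 2 * dI (dI (gZero F φ S)) v
    - 2 * (α S).eval v * (β S).eval v * dI (gOne F α β φ S) v) / ((α S).eval v) ^ 2

end TwoPatch

end

open TwoPatch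

/-
Attach to a `C²` function `f` on the parameter square its coefficients on the edge `u = 0`: `f₀` is
the restriction, `f₁ = (D_u f - β f₀') / α` and `f₂ = (D_uu f - β² f₀'' - 2 α β f₁') / α²`. Under
composition with `φ` they transform by `(φ ∘ f)₁ = φ' f₁` and `(φ ∘ f)₂ = φ''(f₁, f₁) + φ' f₂`, and
`f₀'`, `f₁` form a basis of the plane if `f` is regular. The conditions of bilinear-like `G²`
continuity, with `η` and `θ` accounting for `(α^(L))'` and `(β^(L))'` in `f₁'`, say precisely that
`F^(L)` and `F^(R)` have the same coefficients. Hence `g₁^(L) = g₁^(R)` iff the one-sided first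
derivatives of `φ` agree along the interface, and then `g₂^(L) = g₂^(R)` iff the second ones do: the
tangential and mixed parts of `φ''` come from differentiating `φ'` along the interface. On each
patch `φ` is `C²` because the inverse of a regular parameterization is, and a function that is `C²`
on each of two regular closed patches is `C²` on their union iff its derivatives agree on the
intersection.
-/

open Filter Topology

section InverseOnCompact

section Topology

variable {X Y : Type*} [TopologicalSpace X] [Nonempty X] [TopologicalSpace Y] [T2Space Y]
  {f : X → Y} {s : Set X}

theorem continuousOn_invFunOn_image (hs : IsCompact s) (hf : ContinuousOn f s)
    (hinj : InjOn f s) : ContinuousOn (Function.invFunOn f s) (f '' s) := by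
  refine continuousOn_iff_isClosed.2 fun t ht => ⟨f '' (s ∩ t),
    ((hs.inter_right ht).image_of_continuousOn (hf.mono inter_subset_left)).isClosed, ?_⟩
  ext y
  constructor
  · rintro ⟨hxt, x, hx, rfl⟩
    rw [mem_preimage, hinj.leftInvOn_invFunOn hx] at hxt
    exact ⟨mem_image_of_mem f ⟨hx, hxt⟩, mem_image_of_mem f hx⟩
  · rintro ⟨⟨x, ⟨hx, hxt⟩, rfl⟩, hy⟩
    exact ⟨by rwa [mem_preimage, hinj.leftInvOn_invFunOn hx], hy⟩

end Topology

variable {𝕜 E G H : Type*} [NontriviallyNormedField 𝕜] [NormedAddCommGroup E] [NormedSpace 𝕜 E]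
  [NormedAddCommGroup G] [NormedSpace 𝕜 G] [NormedAddCommGroup H] [NormedSpace 𝕜 H]
  {f : E → G} {s : Set E} {n : ℕ}

theorem hasFDerivWithinAt_invFunOn_image (hs : IsCompact s) (hf : ContinuousOn f s)
    (hinj : InjOn f s) {f' : E →L[𝕜] G} {y : G} (hy : y ∈ f '' s)
    (hf' : HasFDerivWithinAt f f' s (Function.invFunOn f s y)) (hinv : f'.IsInvertible) :
    HasFDerivWithinAt (Function.invFunOn f s) f'.inverse (f '' s) y := by
  obtain ⟨e, rfl⟩ := hinv
  rw [ContinuousLinearMap.inverse_equiv]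
  refine .of_local_left_inverse ?_ hf' hy
    (eventually_mem_nhdsWithin.mono fun _ hz => Function.invFunOn_eq hz)
  exact tendsto_nhdsWithin_iff.2 ⟨continuousOn_invFunOn_image hs hf hinj y hy,
    eventually_mem_nhdsWithin.mono fun _ hz => Function.invFunOn_mem hz⟩

theorem uniqueDiffOn_image_of_isInvertible_fderivWithin (hs : UniqueDiffOn 𝕜 s)
    (hf : DifferentiableOn 𝕜 f s) (hinv : ∀ x ∈ s, (fderivWithin 𝕜 f s x).IsInvertible) :
    UniqueDiffOn 𝕜 (f '' s) := by
  refine hs.image (fun x hx => (hf x hx).hasFDerivWithinAt) fun x hx => ?_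
  obtain ⟨e, he⟩ := hinv x hx
  rw [← he]
  exact e.surjective.denseRange

theorem contDiffOn_invFunOn_image [CompleteSpace E] (hs : IsCompact s) (hu : UniqueDiffOn 𝕜 s)
    (hinj : InjOn f s) (hinv : ∀ x ∈ s, (fderivWithin 𝕜 f s x).IsInvertible)
    (hf : ContDiffOn 𝕜 n f s) : ContDiffOn 𝕜 n (Function.invFunOn f s) (f '' s) := by
  set g := Function.invFunOn f s
  have hg : MapsTo g (f '' s) s := fun _ hy => Function.invFunOn_mem hy
  induction n with
  | zero => exact contDiffOn_zero.2 (continuousOn_invFunOn_image hs hf.continuousOn hinj)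
  | succ n ih =>
    push_cast at hf ⊢
    have hd : DifferentiableOn 𝕜 f s := hf.differentiableOn (by simp)
    have hg' : ∀ y ∈ f '' s, HasFDerivWithinAt g (fderivWithin 𝕜 f s (g y)).inverse (f '' s) y :=
      fun y hy => hasFDerivWithinAt_invFunOn_image hs hf.continuousOn hinj hy
        (hd _ (hg hy)).hasFDerivWithinAt (hinv _ (hg hy))
    have hf'g : ContDiffOn 𝕜 n (fun y => fderivWithin 𝕜 f s (g y)) (f '' s) :=
      (hf.fderivWithin hu le_rfl).comp (ih (hf.of_le le_self_add)) hg
    have hinv_f'g : ContDiffOn 𝕜 n (fun y => (fderivWithin 𝕜 f s (g y)).inverse) (f '' s) :=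
      fun y hy => ContDiffAt.comp_contDiffWithinAt (g := ContinuousLinearMap.inverse) y
        (hinv _ (hg hy)).contDiffAt_map_inverse (hf'g y hy)
    refine contDiffOn_succ_of_fderivWithin (fun y hy => (hg' y hy).differentiableWithinAt)
      (by simp) (hinv_f'g.congr fun y hy => (hg' y hy).fderivWithin ?_)
    exact uniqueDiffOn_image_of_isInvertible_fderivWithin hu hd hinv y hy

theorem contDiffOn_image_of_comp [CompleteSpace E] {φ : G → H} (hs : IsCompact s)
    (hu : UniqueDiffOn 𝕜 s) (hinj : InjOn f s)
    (hinv : ∀ x ∈ s, (fderivWithin 𝕜 f s x).IsInvertible) (hf : ContDiffOn 𝕜 n f s)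
    (hφ : ContDiffOn 𝕜 n (φ ∘ f) s) : ContDiffOn 𝕜 n φ (f '' s) :=
  (hφ.comp (contDiffOn_invFunOn_image hs hu hinj hinv hf)
    fun _ hy => Function.invFunOn_mem hy).congr fun _ hy =>
      congrArg φ (Function.invFunOn_eq hy).symm

end InverseOnCompact

section Interior

variable {𝕜 E G : Type*} [RCLike 𝕜] [NormedAddCommGroup E] [NormedSpace 𝕜 E] [CompleteSpace E]
  [NormedAddCommGroup G] [NormedSpace 𝕜 G] {f : E → G} {s : Set E}

theorem image_interior_subset_interior_image (hf : ContDiffOn 𝕜 1 f s)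
    (hinv : ∀ x ∈ s, (fderivWithin 𝕜 f s x).IsInvertible) :
    f '' interior s ⊆ interior (f '' s) := by
  rintro _ ⟨x, hx, rfl⟩
  have hs : s ∈ 𝓝 x := mem_interior_iff_mem_nhds.1 hx
  obtain ⟨e, he⟩ := hinv x (interior_subset hx)
  have hstrict : HasStrictFDerivAt f (e : E →L[𝕜] G) x := by
    rw [he, fderivWithin_of_mem_nhds hs]
    exact (hf.contDiffAt hs).hasStrictFDerivAt one_ne_zero
  rw [mem_interior_iff_mem_nhds, ← hstrict.map_nhds_eq_of_equiv]
  exact image_mem_map hs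

theorem mem_closure_interior_image (hf : ContDiffOn 𝕜 1 f s)
    (hinv : ∀ x ∈ s, (fderivWithin 𝕜 f s x).IsInvertible) {x : E} (hx : x ∈ s)
    (hx' : x ∈ closure (interior s)) : f x ∈ closure (interior (f '' s)) :=
  closure_mono (image_interior_subset_interior_image hf hinv)
    (((hf.continuousOn x hx).mono interior_subset).mem_closure_image hx')

end Interior

section Gluing

variable {𝕜 E G : Type*} [NontriviallyNormedField 𝕜] [NormedAddCommGroup E] [NormedSpace 𝕜 E]
  [NormedAddCommGroup G] [NormedSpace 𝕜 G] {f : E → G} {s t : Set E}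

theorem hasFDerivWithinAt_union_of_isClosed {f' : E →L[𝕜] G} {x : E} (hs : IsClosed s)
    (ht : IsClosed t) (hfs : x ∈ s → HasFDerivWithinAt f f' s x)
    (hft : x ∈ t → HasFDerivWithinAt f f' t x) : HasFDerivWithinAt f f' (s ∪ t) x := by
  refine .union ?_ ?_
  · by_cases hx : x ∈ s
    exacts [hfs hx, .of_notMem_closure (by rwa [hs.closure_eq])]
  · by_cases hx : x ∈ t
    exacts [hft hx, .of_notMem_closure (by rwa [ht.closure_eq])]

theorem hasFTaylorSeriesUpToOn_union_of_isClosed {n : ℕ∞}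
    {p : E → FormalMultilinearSeries 𝕜 E G} (hs : IsClosed s) (ht : IsClosed t)
    (hps : HasFTaylorSeriesUpToOn n f p s) (hpt : HasFTaylorSeriesUpToOn n f p t) :
    HasFTaylorSeriesUpToOn n f p (s ∪ t) where
  zero_eq x hx := hx.elim (hps.zero_eq x) (hpt.zero_eq x)
  fderivWithin m hm x _ :=
    hasFDerivWithinAt_union_of_isClosed hs ht (hps.fderivWithin m hm x) (hpt.fderivWithin m hm x)
  cont m hm := (hps.cont m hm).union_of_isClosed (hpt.cont m hm) hs ht

theorem uniqueDiffOn_union (hs : UniqueDiffOn 𝕜 s) (ht : UniqueDiffOn 𝕜 t) :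
    UniqueDiffOn 𝕜 (s ∪ t) := fun x hx =>
  hx.elim (fun h => (hs x h).mono subset_union_left) fun h => (ht x h).mono subset_union_right

theorem contDiffOn_union_iff_of_isClosed {n : ℕ∞} (hs : IsClosed s) (ht : IsClosed t)
    (hus : UniqueDiffOn 𝕜 s) (hut : UniqueDiffOn 𝕜 t)
    (hfs : ContDiffOn 𝕜 n f s) (hft : ContDiffOn 𝕜 n f t) :
    ContDiffOn 𝕜 n f (s ∪ t) ↔ ∀ m : ℕ, m ≤ n →
      EqOn (iteratedFDerivWithin 𝕜 m f s) (iteratedFDerivWithin 𝕜 m f t) (s ∩ t) := by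
  classical
  refine ⟨fun hf m hm x ⟨hxs, hxt⟩ => ?_, fun h => ?_⟩
  · have hfm : ContDiffOn 𝕜 m f (s ∪ t) := hf.of_le (by exact_mod_cast hm)
    have hu := uniqueDiffOn_union hus hut
    rw [iteratedFDerivWithin_subset subset_union_left hus hu hfm hxs,
      iteratedFDerivWithin_subset subset_union_right hut hu hfm hxt]
  · let p : E → FormalMultilinearSeries 𝕜 E G := fun x m =>
      if x ∈ s then iteratedFDerivWithin 𝕜 m f s x else iteratedFDerivWithin 𝕜 m f t x
    have hp : HasFTaylorSeriesUpToOn n f p (s ∪ t) := by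
      refine hasFTaylorSeriesUpToOn_union_of_isClosed hs ht
        ((hfs.ftaylorSeriesWithin hus).congr_series fun m _ x hx => ?_)
        ((hft.ftaylorSeriesWithin hut).congr_series fun m hm x hx => ?_)
      · exact (if_pos hx).symm
      · by_cases hxs : x ∈ s
        · exact ((if_pos hxs).trans (h m (by exact_mod_cast hm) ⟨hxs, hx⟩)).symm
        · exact (if_neg hxs).symm
    exact hp.contDiffOn

theorem contDiffOn_two_union_iff_of_isClosed (hs : IsClosed s) (ht : IsClosed t)
    (hus : UniqueDiffOn 𝕜 s) (hut : UniqueDiffOn 𝕜 t)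
    (hfs : ContDiffOn 𝕜 2 f s) (hft : ContDiffOn 𝕜 2 f t) :
    ContDiffOn 𝕜 2 f (s ∪ t) ↔
      EqOn (fderivWithin 𝕜 f s) (fderivWithin 𝕜 f t) (s ∩ t) ∧
      EqOn (fderivWithin 𝕜 (fderivWithin 𝕜 f s) s) (fderivWithin 𝕜 (fderivWithin 𝕜 f t) t)
        (s ∩ t) := by
  refine (contDiffOn_union_iff_of_isClosed (n := 2) hs ht hus hut hfs hft).trans
    ⟨fun h => ⟨fun x hx => ?_, fun x hx => ?_⟩, fun ⟨h₁, h₂⟩ m hm x hx => ?_⟩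
  · ext v
    simpa only [iteratedFDerivWithin_one_apply (hus x hx.1),
      iteratedFDerivWithin_one_apply (hut x hx.2)]
      using congrArg (· fun _ => v) (h 1 (by norm_num) hx)
  · ext v w
    simpa only [iteratedFDerivWithin_two_apply _ hus hx.1,
      iteratedFDerivWithin_two_apply _ hut hx.2, Matrix.cons_val_zero, Matrix.cons_val_one]
      using congrArg (· ![v, w]) (h 2 le_rfl hx)
  · ext v
    have hm' : m ≤ 2 := by exact_mod_cast hm
    interval_cases m
    · simp
    · rw [iteratedFDerivWithin_one_apply (hus x hx.1),
        iteratedFDerivWithin_one_apply (hut x hx.2), h₁ hx]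
    · rw [iteratedFDerivWithin_two_apply _ hus hx.1, iteratedFDerivWithin_two_apply _ hut hx.2,
        h₂ hx]

end Gluing

namespace TwoPatch

variable {E G : Type*} [NormedAddCommGroup E] [NormedSpace ℝ E]
  [NormedAddCommGroup G] [NormedSpace ℝ G]

section UnitSquare

theorem uniqueDiffOn_unitI : UniqueDiffOn ℝ unitI := uniqueDiffOn_Icc zero_lt_one

theorem zero_mem_unitI : (0 : ℝ) ∈ unitI := left_mem_Icc.2 zero_le_one

theorem zero_mk_mem_unitSq {v : ℝ} (hv : v ∈ unitI) : ((0 : ℝ), v) ∈ unitSq :=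
  ⟨zero_mem_unitI, hv⟩

theorem isCompact_unitSq : IsCompact unitSq := isCompact_Icc.prod isCompact_Icc

theorem uniqueDiffOn_unitSq : UniqueDiffOn ℝ unitSq := uniqueDiffOn_unitI.prod uniqueDiffOn_unitI

theorem unitSq_subset_closure_interior : unitSq ⊆ closure (interior unitSq) := by
  rw [unitSq, interior_prod_eq, closure_prod_eq, unitI, interior_Icc, closure_Ioo zero_ne_one]

end UnitSquare

section OneSidedDerivatives

theorem dI_congr {f g : ℝ → E} (h : EqOn f g unitI) {t : ℝ} (ht : t ∈ unitI) : dI f t = dI g t :=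
  derivWithin_congr h (h ht)

theorem dI_eq_of_hasDerivWithinAt {f : ℝ → E} {f' : E} {t : ℝ}
    (h : HasDerivWithinAt f f' unitI t) (ht : t ∈ unitI) : dI f t = f' :=
  h.derivWithin (uniqueDiffOn_unitI t ht)

theorem hasDerivWithinAt_dI {f : ℝ → E} (hf : DifferentiableOn ℝ f unitI) {t : ℝ}
    (ht : t ∈ unitI) : HasDerivWithinAt f (dI f t) unitI t :=
  (hf t ht).hasDerivWithinAt

theorem differentiableOn_dI {f : ℝ → E} (hf : ContDiffOn ℝ 2 f unitI) :
    DifferentiableOn ℝ (dI f) unitI :=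
  (hf.derivWithin (m := 1) uniqueDiffOn_unitI (by norm_num)).differentiableOn one_ne_zero

variable {f : ℝ × ℝ → E} {x : ℝ × ℝ}

theorem hasDerivWithinAt_fst_slice (hf : DifferentiableOn ℝ f unitSq) (hx : x ∈ unitSq) :
    HasDerivWithinAt (fun s => f (s, x.2)) (fderivWithin ℝ f unitSq x (1, 0)) unitI x.1 :=
  (hf x hx).hasFDerivWithinAt.comp_hasDerivWithinAt (f := fun s => (s, x.2)) x.1
    ((hasDerivWithinAt_id _ _).prodMk (hasDerivWithinAt_const _ _ _)) fun _ hs => ⟨hs, hx.2⟩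

theorem hasDerivWithinAt_snd_slice (hf : DifferentiableOn ℝ f unitSq) (hx : x ∈ unitSq) :
    HasDerivWithinAt (fun t => f (x.1, t)) (fderivWithin ℝ f unitSq x (0, 1)) unitI x.2 :=
  (hf x hx).hasFDerivWithinAt.comp_hasDerivWithinAt (f := fun t => (x.1, t)) x.2
    ((hasDerivWithinAt_const _ _ _).prodMk (hasDerivWithinAt_id _ _)) fun _ ht => ⟨hx.1, ht⟩

theorem dU_eq_fderivWithin (hf : DifferentiableOn ℝ f unitSq) (hx : x ∈ unitSq) :
    dU f x = fderivWithin ℝ f unitSq x (1, 0) :=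
  dI_eq_of_hasDerivWithinAt (hasDerivWithinAt_fst_slice hf hx) hx.1

theorem dV_eq_fderivWithin (hf : DifferentiableOn ℝ f unitSq) (hx : x ∈ unitSq) :
    dV f x = fderivWithin ℝ f unitSq x (0, 1) :=
  dI_eq_of_hasDerivWithinAt (hasDerivWithinAt_snd_slice hf hx) hx.2

theorem hasDerivWithinAt_dU (hf : DifferentiableOn ℝ f unitSq) (hx : x ∈ unitSq) :
    HasDerivWithinAt (fun s => f (s, x.2)) (dU f x) unitI x.1 :=
  dU_eq_fderivWithin hf hx ▸ hasDerivWithinAt_fst_slice hf hx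

theorem differentiableOn_dU (hf : ContDiffOn ℝ 2 f unitSq) : DifferentiableOn ℝ (dU f) unitSq := by
  have hf' : DifferentiableOn ℝ (fderivWithin ℝ f unitSq) unitSq :=
    (hf.fderivWithin (m := 1) uniqueDiffOn_unitSq (by norm_num)).differentiableOn one_ne_zero
  exact (hf'.clm_apply (differentiableOn_const _)).congr fun _ hx =>
    dU_eq_fderivWithin (hf.differentiableOn two_ne_zero) hx

end OneSidedDerivatives

section EdgeCoefficients

/-- The restriction `f₀` of `f` to the edge `u = 0`; for `f = g^(S)` this is `g₀`. -/
def edgeZero (f : ℝ × ℝ → E) (v : ℝ) : E := f (0, v)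

/-- The first-order coefficient `f₁ = (D_u f - b f₀') / a` of `f` on the edge `u = 0`. It is the
derivative of `f` in the direction `(1 / a, -b / a)` of the parameter domain. -/
noncomputable def edgeOne (f : ℝ × ℝ → E) (a b : ℝ → ℝ) (v : ℝ) : E :=
  (a v)⁻¹ • (dU f (0, v) - b v • dI (edgeZero f) v)

/-- The second-order coefficient `f₂ = (D_uu f - b² f₀'' - 2 a b f₁') / a²` of `f` on the edge
`u = 0`. Together with `f₀` and `f₁` it determines the derivatives of `f` up to order two there. -/
noncomputable def edgeTwo (f : ℝ × ℝ → E) (a b : ℝ → ℝ) (v : ℝ) : E :=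
  (a v ^ 2)⁻¹ • (dU (dU f) (0, v) - b v ^ 2 • dI (dI (edgeZero f)) v
    - (2 * a v * b v) • dI (edgeOne f a b) v)

variable {f : ℝ × ℝ → E} {a b : ℝ → ℝ} {v : ℝ}

theorem contDiffOn_edgeZero {n : WithTop ℕ∞} (hf : ContDiffOn ℝ n f unitSq) :
    ContDiffOn ℝ n (edgeZero f) unitI :=
  hf.comp (contDiff_prodMk_right (0 : ℝ)).contDiffOn fun _ hv => zero_mk_mem_unitSq hv

theorem differentiableOn_edgeZero (hf : DifferentiableOn ℝ f unitSq) :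
    DifferentiableOn ℝ (edgeZero f) unitI := fun _ hv =>
  (hasDerivWithinAt_snd_slice hf (zero_mk_mem_unitSq hv)).differentiableWithinAt

theorem dU_eq_smul_edgeOne_add (ha : a v ≠ 0) :
    dU f (0, v) = a v • edgeOne f a b v + b v • dI (edgeZero f) v := by
  rw [edgeOne, smul_inv_smul₀ ha, sub_add_cancel]

theorem hasDerivWithinAt_edgeOne (hf : ContDiffOn ℝ 2 f unitSq) (ha : DifferentiableOn ℝ a unitI)
    (hb : DifferentiableOn ℝ b unitI) (hv : v ∈ unitI) (hav : a v ≠ 0) :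
    HasDerivWithinAt (edgeOne f a b)
      ((a v)⁻¹ • (dV (dU f) (0, v) - b v • dI (dI (edgeZero f)) v
        - dI b v • dI (edgeZero f) v - dI a v • edgeOne f a b v)) unitI v := by
  have hdU : HasDerivWithinAt (fun t => dU f (0, t)) (dV (dU f) (0, v)) unitI v :=
    hasDerivWithinAt_dI (differentiableOn_edgeZero (differentiableOn_dU hf)) hv
  have hf₀' := hasDerivWithinAt_dI (differentiableOn_dI (contDiffOn_edgeZero hf)) hv
  have hinv : HasDerivWithinAt (fun t => (a t)⁻¹) (-dI a v / a v ^ 2) unitI v :=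
    (hasDerivWithinAt_dI ha hv).inv hav
  have hdiff : HasDerivWithinAt (fun t => dU f (0, t) - b t • dI (edgeZero f) t) _ unitI v :=
    hdU.sub ((hasDerivWithinAt_dI hb hv).smul hf₀')
  convert! hinv.smul hdiff using 1
  rw [edgeOne]
  match_scalars <;> field_simp
  ring

theorem differentiableOn_edgeOne (hf : ContDiffOn ℝ 2 f unitSq) (ha : DifferentiableOn ℝ a unitI)
    (hb : DifferentiableOn ℝ b unitI) (ha₀ : ∀ v ∈ unitI, a v ≠ 0) :
    DifferentiableOn ℝ (edgeOne f a b) unitI := fun v hv =>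
  (hasDerivWithinAt_edgeOne hf ha hb hv (ha₀ v hv)).differentiableWithinAt

end EdgeCoefficients

section ChainRule

/-- The derivative of `φ`, relative to the patch parameterized by `f`, along the edge `u = 0`. -/
noncomputable def edgeGrad (φ : E → G) (f : ℝ × ℝ → E) (v : ℝ) : E →L[ℝ] G :=
  fderivWithin ℝ φ (f '' unitSq) (f (0, v))

/-- The second derivative of `φ`, relative to the patch parameterized by `f`, along the edge
`u = 0`. -/
noncomputable def edgeHess (φ : E → G) (f : ℝ × ℝ → E) (v : ℝ) : E →L[ℝ] E →L[ℝ] G :=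
  fderivWithin ℝ (fderivWithin ℝ φ (f '' unitSq)) (f '' unitSq) (f (0, v))

variable {f : ℝ × ℝ → E} {φ : E → G} {a b : ℝ → ℝ} {v : ℝ}

theorem dU_comp (hf : DifferentiableOn ℝ f unitSq) (hφ : DifferentiableOn ℝ φ (f '' unitSq))
    {x : ℝ × ℝ} (hx : x ∈ unitSq) :
    dU (φ ∘ f) x = fderivWithin ℝ φ (f '' unitSq) (f x) (dU f x) :=
  dI_eq_of_hasDerivWithinAt ((hφ _ (mem_image_of_mem f hx)).hasFDerivWithinAt.comp_hasDerivWithinAt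
    (f := fun s => f (s, x.2)) x.1 (hasDerivWithinAt_dU hf hx)
    fun _ hs => mem_image_of_mem f ⟨hs, hx.2⟩) hx.1

theorem dI_edgeZero_comp (hf : DifferentiableOn ℝ f unitSq)
    (hφ : DifferentiableOn ℝ φ (f '' unitSq)) (hv : v ∈ unitI) :
    dI (edgeZero (φ ∘ f)) v = edgeGrad φ f v (dI (edgeZero f) v) :=
  dI_eq_of_hasDerivWithinAt
    ((hφ _ (mem_image_of_mem f (zero_mk_mem_unitSq hv))).hasFDerivWithinAt.comp_hasDerivWithinAt
      (f := edgeZero f) v (hasDerivWithinAt_dI (differentiableOn_edgeZero hf) hv)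
      fun _ ht => mem_image_of_mem f (zero_mk_mem_unitSq ht)) hv

theorem edgeOne_comp (hf : DifferentiableOn ℝ f unitSq) (hφ : DifferentiableOn ℝ φ (f '' unitSq))
    (hv : v ∈ unitI) : edgeOne (φ ∘ f) a b v = edgeGrad φ f v (edgeOne f a b v) := by
  rw [edgeOne, edgeOne, dU_comp hf hφ (zero_mk_mem_unitSq hv), dI_edgeZero_comp hf hφ hv,
    ← edgeGrad, map_smul, map_sub, map_smul]

theorem hasDerivWithinAt_edgeGrad (hf : DifferentiableOn ℝ f unitSq)
    (hφ : DifferentiableOn ℝ (fderivWithin ℝ φ (f '' unitSq)) (f '' unitSq)) (hv : v ∈ unitI) :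
    HasDerivWithinAt (edgeGrad φ f) (edgeHess φ f v (dI (edgeZero f) v)) unitI v :=
  (hφ _ (mem_image_of_mem f (zero_mk_mem_unitSq hv))).hasFDerivWithinAt.comp_hasDerivWithinAt
    (f := edgeZero f) v (hasDerivWithinAt_dI (differentiableOn_edgeZero hf) hv)
    fun _ ht => mem_image_of_mem f (zero_mk_mem_unitSq ht)

theorem dI_edgeGrad_apply {w : ℝ → E} (hf : DifferentiableOn ℝ f unitSq)
    (hφ : DifferentiableOn ℝ (fderivWithin ℝ φ (f '' unitSq)) (f '' unitSq))
    (hw : DifferentiableOn ℝ w unitI) (hv : v ∈ unitI) :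
    dI (fun t => edgeGrad φ f t (w t)) v
      = edgeHess φ f v (dI (edgeZero f) v) (w v) + edgeGrad φ f v (dI w v) :=
  dI_eq_of_hasDerivWithinAt
    ((hasDerivWithinAt_edgeGrad hf hφ hv).clm_apply (hasDerivWithinAt_dI hw hv)) hv

theorem dU_dU_comp (hf : ContDiffOn ℝ 2 f unitSq) (hφ : DifferentiableOn ℝ φ (f '' unitSq))
    (hφ' : DifferentiableOn ℝ (fderivWithin ℝ φ (f '' unitSq)) (f '' unitSq)) (hv : v ∈ unitI) :
    dU (dU (φ ∘ f)) (0, v) = edgeHess φ f v (dU f (0, v)) (dU f (0, v))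
      + edgeGrad φ f v (dU (dU f) (0, v)) := by
  have hfd := hf.differentiableOn two_ne_zero
  have hx := zero_mk_mem_unitSq hv
  have hgrad : HasDerivWithinAt (fun s => fderivWithin ℝ φ (f '' unitSq) (f (s, v)))
      (edgeHess φ f v (dU f (0, v))) unitI 0 :=
    (hφ' _ (mem_image_of_mem f hx)).hasFDerivWithinAt.comp_hasDerivWithinAt
      (f := fun s => f (s, v)) 0 (hasDerivWithinAt_dU hfd hx)
      fun _ hs => mem_image_of_mem f ⟨hs, hv⟩
  calc dU (dU (φ ∘ f)) (0, v)
      = dI (fun s => fderivWithin ℝ φ (f '' unitSq) (f (s, v)) (dU f (s, v))) 0 :=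
        dI_congr (fun s hs => dU_comp hfd hφ (x := (s, v)) ⟨hs, hv⟩) zero_mem_unitI
    _ = _ := dI_eq_of_hasDerivWithinAt
        (hgrad.clm_apply (hasDerivWithinAt_dU (differentiableOn_dU hf) hx)) zero_mem_unitI

/-- The mixed terms of `φ''` produced by `D_uu (φ ∘ f)` and by `f₁'` cancel because `φ''` is
symmetric; only its value on `f₁` survives. -/
theorem edgeTwo_comp (hf : ContDiffOn ℝ 2 f unitSq) (hφ : DifferentiableOn ℝ φ (f '' unitSq))
    (hφ' : DifferentiableOn ℝ (fderivWithin ℝ φ (f '' unitSq)) (f '' unitSq))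
    (ha : DifferentiableOn ℝ a unitI) (hb : DifferentiableOn ℝ b unitI)
    (ha₀ : ∀ v ∈ unitI, a v ≠ 0) (hv : v ∈ unitI)
    (hsymm : IsSymmSndFDerivWithinAt ℝ φ (f '' unitSq) (f (0, v))) :
    edgeTwo (φ ∘ f) a b v = edgeHess φ f v (edgeOne f a b v) (edgeOne f a b v)
      + edgeGrad φ f v (edgeTwo f a b v) := by
  have hfd := hf.differentiableOn two_ne_zero
  have hf₀'' : dI (dI (edgeZero (φ ∘ f))) v = _ :=
    (dI_congr (fun _ ht => dI_edgeZero_comp hfd hφ ht) hv).trans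
      (dI_edgeGrad_apply hfd hφ' (differentiableOn_dI (contDiffOn_edgeZero hf)) hv)
  have hf₁' : dI (edgeOne (φ ∘ f) a b) v = _ :=
    (dI_congr (fun _ ht => edgeOne_comp hfd hφ ht) hv).trans
      (dI_edgeGrad_apply hfd hφ' (differentiableOn_edgeOne hf ha hb ha₀) hv)
  have hav := ha₀ v hv
  have hcomm : edgeHess φ f v (edgeOne f a b v) (dI (edgeZero f) v)
      = edgeHess φ f v (dI (edgeZero f) v) (edgeOne f a b v) := hsymm _ _
  rw [edgeTwo, edgeTwo, dU_dU_comp hf hφ hφ' hv, hf₀'', hf₁',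
    dU_eq_smul_edgeOne_add (f := f) (b := b) hav]
  simp only [map_add, map_sub, map_smul, add_apply, smul_apply, hcomm]
  match_scalars <;> field_simp
  all_goals ring

end ChainRule

section RegularPatch

/-- A `C²` parameterization of the patch `f '' unitSq` that is injective and whose derivative,
one-sided at the boundary, is invertible everywhere. -/
structure IsRegularPatch (f : ℝ × ℝ → E) : Prop where
  contDiffOn : ContDiffOn ℝ 2 f unitSq
  injOn : InjOn f unitSq
  isInvertible_fderivWithin : ∀ x ∈ unitSq, (fderivWithin ℝ f unitSq x).IsInvertible

namespace IsRegularPatch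

variable {f : ℝ × ℝ → E} {φ : E → G} {a b : ℝ → ℝ} {v : ℝ}

theorem differentiableOn (hf : IsRegularPatch f) : DifferentiableOn ℝ f unitSq :=
  hf.contDiffOn.differentiableOn two_ne_zero

theorem isClosed_image (hf : IsRegularPatch f) : IsClosed (f '' unitSq) :=
  (isCompact_unitSq.image_of_continuousOn hf.contDiffOn.continuousOn).isClosed

theorem uniqueDiffOn_image (hf : IsRegularPatch f) : UniqueDiffOn ℝ (f '' unitSq) :=
  uniqueDiffOn_image_of_isInvertible_fderivWithin uniqueDiffOn_unitSq hf.differentiableOn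
    hf.isInvertible_fderivWithin

theorem contDiffOn_image_iff (hf : IsRegularPatch f) :
    ContDiffOn ℝ 2 φ (f '' unitSq) ↔ ContDiffOn ℝ 2 (φ ∘ f) unitSq :=
  ⟨fun hφ => hφ.comp hf.contDiffOn (mapsTo_image f unitSq), fun hφ =>
    contDiffOn_image_of_comp (n := 2) isCompact_unitSq uniqueDiffOn_unitSq hf.injOn
      hf.isInvertible_fderivWithin hf.contDiffOn hφ⟩

theorem differentiableOn_fderivWithin (hf : IsRegularPatch f)
    (hφ : ContDiffOn ℝ 2 φ (f '' unitSq)) :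
    DifferentiableOn ℝ (fderivWithin ℝ φ (f '' unitSq)) (f '' unitSq) :=
  (hφ.fderivWithin (m := 1) hf.uniqueDiffOn_image (by norm_num)).differentiableOn one_ne_zero

theorem isSymmSndFDerivWithinAt (hf : IsRegularPatch f) (hφ : ContDiffOn ℝ 2 φ (f '' unitSq))
    {x : ℝ × ℝ} (hx : x ∈ unitSq) : IsSymmSndFDerivWithinAt ℝ φ (f '' unitSq) (f x) :=
  (hφ _ (mem_image_of_mem f hx)).isSymmSndFDerivWithinAt (by simp) hf.uniqueDiffOn_image
    (mem_closure_interior_image (hf.contDiffOn.of_le one_le_two) hf.isInvertible_fderivWithin hx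
      (unitSq_subset_closure_interior hx)) (mem_image_of_mem f hx)

theorem edgeHess_comm (hf : IsRegularPatch f) (hφ : ContDiffOn ℝ 2 φ (f '' unitSq))
    (hv : v ∈ unitI) (w z : E) : edgeHess φ f v w z = edgeHess φ f v z w :=
  hf.isSymmSndFDerivWithinAt hφ (zero_mk_mem_unitSq hv) w z

theorem clm_ext (hf : IsRegularPatch f) (hv : v ∈ unitI) (hav : a v ≠ 0) {A B : E →L[ℝ] G}
    (htangent : A (dI (edgeZero f) v) = B (dI (edgeZero f) v))
    (htransversal : A (edgeOne f a b v) = B (edgeOne f a b v)) : A = B := by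
  have hx := zero_mk_mem_unitSq hv
  have hU : A (fderivWithin ℝ f unitSq (0, v) (1, 0))
      = B (fderivWithin ℝ f unitSq (0, v) (1, 0)) := by
    rw [← dU_eq_fderivWithin hf.differentiableOn hx, dU_eq_smul_edgeOne_add (b := b) hav]
    simp only [map_add, map_smul, htangent, htransversal]
  have hV : A (fderivWithin ℝ f unitSq (0, v) (0, 1))
      = B (fderivWithin ℝ f unitSq (0, v) (0, 1)) := by
    rw [← dV_eq_fderivWithin hf.differentiableOn hx]
    exact htangent
  obtain ⟨e, he⟩ := hf.isInvertible_fderivWithin _ hx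
  have hcomp : A.comp (e : ℝ × ℝ →L[ℝ] E) = B.comp (e : ℝ × ℝ →L[ℝ] E) := by
    rw [he]
    ext <;> simpa
  ext w
  simpa using congrArg (fun C => C (e.symm w)) hcomp

end IsRegularPatch

end RegularPatch

section G2Gluing

/-- `G²` continuity of the parameterizations `F .L` and `F .R` along the edge `u = 0`: their edge
coefficients, taken with `a S` and `b S` in the roles of `α^(S)` and `β^(S)`, agree. -/
structure IsG2Gluing (F : Side → ℝ × ℝ → E) (a b : Side → ℝ → ℝ) : Prop where
  differentiableOn_a : ∀ S, DifferentiableOn ℝ (a S) unitI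
  differentiableOn_b : ∀ S, DifferentiableOn ℝ (b S) unitI
  a_ne_zero : ∀ S, ∀ v ∈ unitI, a S v ≠ 0
  edgeZero_eqOn : EqOn (edgeZero (F .L)) (edgeZero (F .R)) unitI
  edgeOne_eqOn : EqOn (edgeOne (F .L) (a .L) (b .L)) (edgeOne (F .R) (a .R) (b .R)) unitI
  edgeTwo_eqOn : EqOn (edgeTwo (F .L) (a .L) (b .L)) (edgeTwo (F .R) (a .R) (b .R)) unitI

variable {F : Side → ℝ × ℝ → E} {a b : Side → ℝ → ℝ} {φ : E → G}

namespace IsG2Gluing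

theorem edgeGrad_eqOn_iff (hab : IsG2Gluing F a b) (hF : ∀ S, IsRegularPatch (F S))
    (hφ : ∀ S, ContDiffOn ℝ 2 φ (F S '' unitSq)) :
    EqOn (edgeGrad φ (F .L)) (edgeGrad φ (F .R)) unitI ↔
      EqOn (edgeOne (φ ∘ F .L) (a .L) (b .L)) (edgeOne (φ ∘ F .R) (a .R) (b .R)) unitI := by
  have hφ' S := (hφ S).differentiableOn two_ne_zero
  refine forall₂_congr fun v hv => ?_
  rw [edgeOne_comp (hF .L).differentiableOn (hφ' .L) hv,
    edgeOne_comp (hF .R).differentiableOn (hφ' .R) hv, ← hab.edgeOne_eqOn hv]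
  refine ⟨fun h => by rw [h], (hF .L).clm_ext hv (hab.a_ne_zero .L v hv) ?_⟩
  have hg₀' : dI (edgeZero (φ ∘ F .L)) v = dI (edgeZero (φ ∘ F .R)) v :=
    dI_congr (hab.edgeZero_eqOn.comp_left (g := φ)) hv
  rwa [dI_edgeZero_comp (hF .L).differentiableOn (hφ' .L) hv,
    dI_edgeZero_comp (hF .R).differentiableOn (hφ' .R) hv,
    ← dI_congr hab.edgeZero_eqOn hv] at hg₀'

theorem edgeHess_eqOn_iff (hab : IsG2Gluing F a b) (hF : ∀ S, IsRegularPatch (F S))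
    (hφ : ∀ S, ContDiffOn ℝ 2 φ (F S '' unitSq))
    (hgrad : EqOn (edgeGrad φ (F .L)) (edgeGrad φ (F .R)) unitI) :
    EqOn (edgeHess φ (F .L)) (edgeHess φ (F .R)) unitI ↔
      EqOn (edgeTwo (φ ∘ F .L) (a .L) (b .L)) (edgeTwo (φ ∘ F .R) (a .R) (b .R)) unitI := by
  refine forall₂_congr fun v hv => ?_
  have htwo S := edgeTwo_comp (hF S).contDiffOn ((hφ S).differentiableOn two_ne_zero)
    ((hF S).differentiableOn_fderivWithin (hφ S)) (hab.differentiableOn_a S)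
    (hab.differentiableOn_b S) (hab.a_ne_zero S) hv
    ((hF S).isSymmSndFDerivWithinAt (hφ S) (zero_mk_mem_unitSq hv))
  rw [htwo .L, htwo .R, ← hab.edgeOne_eqOn hv, ← hab.edgeTwo_eqOn hv, hgrad hv, add_left_inj]
  have htangent : edgeHess φ (F .L) v (dI (edgeZero (F .L)) v)
      = edgeHess φ (F .R) v (dI (edgeZero (F .L)) v) := by
    have hderiv S := hasDerivWithinAt_edgeGrad (hF S).differentiableOn
      ((hF S).differentiableOn_fderivWithin (hφ S)) hv
    rw [dI_congr hab.edgeZero_eqOn hv, ← dI_eq_of_hasDerivWithinAt (hderiv .R) hv,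
      ← dI_congr hab.edgeZero_eqOn hv, ← dI_eq_of_hasDerivWithinAt (hderiv .L) hv]
    exact dI_congr hgrad hv
  have hav := hab.a_ne_zero .L v hv
  refine ⟨fun h => by rw [h], fun htransversal =>
    (hF .L).clm_ext hv hav htangent ((hF .L).clm_ext hv hav ?_ htransversal)⟩
  rw [(hF .L).edgeHess_comm (hφ .L) hv, (hF .R).edgeHess_comm (hφ .R) hv, htangent]

theorem contDiffOn_union_iff (hab : IsG2Gluing F a b) (hF : ∀ S, IsRegularPatch (F S))
    (hinter : F .L '' unitSq ∩ F .R '' unitSq = edgeZero (F .L) '' unitI)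
    (hφ : ∀ S, ContDiffOn ℝ 2 φ (F S '' unitSq)) :
    ContDiffOn ℝ 2 φ (F .L '' unitSq ∪ F .R '' unitSq) ↔
      EqOn (edgeGrad φ (F .L)) (edgeGrad φ (F .R)) unitI ∧
      EqOn (edgeHess φ (F .L)) (edgeHess φ (F .R)) unitI := by
  have hedge {Y : Type _} (l r : E → Y) : EqOn l r (edgeZero (F .L) '' unitI) ↔
      EqOn (fun v => l (F .L (0, v))) (fun v => r (F .R (0, v))) unitI :=
    forall_mem_image.trans <| forall₂_congr fun v hv =>
      (congrArg (fun y => l (F .L (0, v)) = r y) (hab.edgeZero_eqOn hv)).to_iff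
  rw [contDiffOn_two_union_iff_of_isClosed (hF .L).isClosed_image (hF .R).isClosed_image
    (hF .L).uniqueDiffOn_image (hF .R).uniqueDiffOn_image (hφ .L) (hφ .R), hinter]
  exact and_congr (hedge _ _) (hedge _ _)

end IsG2Gluing

theorem lemma1_general (hF : ∀ S, IsRegularPatch (F S))
    (hinter : F .L '' unitSq ∩ F .R '' unitSq = edgeZero (F .L) '' unitI)
    (hab : IsG2Gluing F a b) (hφ : ∀ S, ContDiffOn ℝ 2 (φ ∘ F S) unitSq) :
    ContDiffOn ℝ 2 φ (F .L '' unitSq ∪ F .R '' unitSq) ↔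
      EqOn (edgeZero (φ ∘ F .L)) (edgeZero (φ ∘ F .R)) unitI ∧
      EqOn (edgeOne (φ ∘ F .L) (a .L) (b .L)) (edgeOne (φ ∘ F .R) (a .R) (b .R)) unitI ∧
      EqOn (edgeTwo (φ ∘ F .L) (a .L) (b .L)) (edgeTwo (φ ∘ F .R) (a .R) (b .R)) unitI := by
  have hφ' S := (hF S).contDiffOn_image_iff.2 (hφ S)
  have hzero : EqOn (edgeZero (φ ∘ F .L)) (edgeZero (φ ∘ F .R)) unitI :=
    hab.edgeZero_eqOn.comp_left (g := φ)
  rw [hab.contDiffOn_union_iff hF hinter hφ', and_iff_right hzero,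
    ← hab.edgeGrad_eqOn_iff hF hφ']
  exact and_congr_right fun hgrad => hab.edgeHess_eqOn_iff hF hφ' hgrad

end G2Gluing

section IsogeometricFunctions

theorem det₂_smul_eq (w z y : ℝ × ℝ) : det₂ w z • y = det₂ y z • w + det₂ w y • z := by
  ext <;> simp [det₂] <;> ring

theorem isInvertible_of_det₂_ne_zero {A : ℝ × ℝ →L[ℝ] ℝ × ℝ}
    (hA : det₂ (A (1, 0)) (A (0, 1)) ≠ 0) : A.IsInvertible := by
  have hsurj : Function.Surjective A := fun y => by
    refine ⟨(det₂ (A (1, 0)) (A (0, 1)))⁻¹ •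
      (det₂ y (A (0, 1)) • (1, 0) + det₂ (A (1, 0)) y • (0, 1)), ?_⟩
    simp only [map_smul, map_add]
    rw [← det₂_smul_eq, inv_smul_smul₀ hA]
  exact ⟨ContinuousLinearEquiv.ofBijective A
    (LinearMap.ker_eq_bot.2 (LinearMap.injective_iff_surjective.2 hsurj))
    (LinearMap.range_eq_top.2 hsurj), ContinuousLinearEquiv.coe_ofBijective ..⟩

variable {p r k : ℕ} {τ : Fin k → ℝ}

theorem contDiffOn_of_mem_splineSpace₂ {g : ℝ × ℝ → ℝ} (hg : g ∈ splineSpace₂ p r τ) :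
    ContDiffOn ℝ r g unitSq := by
  obtain ⟨n, a, b, ha, hb, hgab⟩ := hg
  have hsum : ContDiffOn ℝ r (fun x : ℝ × ℝ => ∑ i, a i x.1 * b i x.2) unitSq :=
    .sum fun i _ => ((ha i).1.comp contDiffOn_fst fun _ hx => hx.1).mul
      ((hb i).1.comp contDiffOn_snd fun _ hx => hx.2)
  exact hsum.congr fun x hx => hgab x.1 hx.1 x.2 hx.2

variable {F : Side → ℝ × ℝ → ℝ × ℝ} {α β : Side → ℝ[X]} {φ : ℝ × ℝ → ℝ}

theorem IsTwoPatchParameterization.isRegularPatch (hF : IsTwoPatchParameterization p r τ F)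
    (hr : 2 ≤ r) (S : Side) : IsRegularPatch (F S) := by
  have hF₂ : ContDiffOn ℝ 2 (F S) unitSq :=
    ((contDiffOn_of_mem_splineSpace₂ (hF.spline_fst S)).prodMk
      (contDiffOn_of_mem_splineSpace₂ (hF.spline_snd S))).of_le (by exact_mod_cast hr)
  refine ⟨hF₂, hF.injective S, fun x hx => isInvertible_of_det₂_ne_zero ?_⟩
  have hd := hF₂.differentiableOn two_ne_zero
  rw [← dU_eq_fderivWithin hd hx, ← dV_eq_fderivWithin hd hx]
  exact hF.regular S x hx

theorem contDiffOn_comp_of_mem_isogeometricSpace (hφ : φ ∈ isogeometricSpace p r τ F)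
    (hr : 2 ≤ r) (S : Side) : ContDiffOn ℝ 2 (φ ∘ F S) unitSq :=
  (contDiffOn_of_mem_splineSpace₂ (hφ S)).of_le (by exact_mod_cast hr)

theorem dI_polynomial_eval (P : ℝ[X]) {v : ℝ} (hv : v ∈ unitI) :
    dI P.eval v = (derivative P).eval v :=
  dI_eq_of_hasDerivWithinAt (P.hasDerivWithinAt v unitI) hv

namespace IsBilinearLikeG2With

theorem eval_alpha_ne_zero (hαβ : IsBilinearLikeG2With F α β) (S : Side) {v : ℝ}
    (hv : v ∈ unitI) : (α S).eval v ≠ 0 := by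
  have hne := (hαβ.alpha_mul_neg v hv).ne
  cases S
  exacts [left_ne_zero_of_mul hne, right_ne_zero_of_mul hne]

theorem edgeZero_eqOn (hαβ : IsBilinearLikeG2With F α β) :
    EqOn (edgeZero (F .L)) (edgeZero (F .R)) unitI := hαβ.edge_eq

theorem edgeOne_eqOn (hαβ : IsBilinearLikeG2With F α β) :
    EqOn (edgeOne (F .L) (α .L).eval (β .L).eval) (edgeOne (F .R) (α .R).eval (β .R).eval)
      unitI := fun v hv => by
  have haL := hαβ.eval_alpha_ne_zero .L hv
  have haR := hαβ.eval_alpha_ne_zero .R hv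
  have hfirst := hαβ.first_order v hv
  rw [gluingBeta, show dV (F .L) (0, v) = dI (edgeZero (F .L)) v from rfl] at hfirst
  rw [edgeOne, edgeOne, ← dI_congr hαβ.edgeZero_eqOn hv]
  linear_combination (norm := skip) ((α .L).eval v * (α .R).eval v)⁻¹ • hfirst
  match_scalars <;> field_simp <;> ring

theorem edgeTwo_eqOn (hαβ : IsBilinearLikeG2With F α β) (hF : ContDiffOn ℝ 2 (F .L) unitSq) :
    EqOn (edgeTwo (F .L) (α .L).eval (β .L).eval) (edgeTwo (F .R) (α .R).eval (β .R).eval)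
      unitI := fun v hv => by
  have haL := hαβ.eval_alpha_ne_zero .L hv
  have haR := hαβ.eval_alpha_ne_zero .R hv
  have hf₀' : EqOn (dI (edgeZero (F .L))) (dI (edgeZero (F .R))) unitI :=
    fun _ => dI_congr hαβ.edgeZero_eqOn
  have hf₁' : dI (edgeOne (F .L) (α .L).eval (β .L).eval) v = _ := dI_eq_of_hasDerivWithinAt
    (hasDerivWithinAt_edgeOne hF (α .L).differentiableOn (β .L).differentiableOn hv haL) hv
  have hsecond := hαβ.second_order v hv
  rw [gluingZ, gluingEta, gluingTheta, gluingBeta,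
    show dV (F .L) (0, v) = dI (edgeZero (F .L)) v from rfl,
    show interfaceCurve F = edgeZero (F .L) from rfl] at hsecond
  rw [edgeTwo, edgeTwo, ← dI_congr hf₀' hv, ← dI_congr hαβ.edgeOne_eqOn hv, hf₁',
    dI_polynomial_eval _ hv, dI_polynomial_eval _ hv, edgeOne]
  linear_combination (norm := skip) -((α .L).eval v ^ 3 * (α .R).eval v ^ 2)⁻¹ • hsecond
  match_scalars <;> field_simp <;> ring

theorem isG2Gluing (hαβ : IsBilinearLikeG2With F α β) (hF : ContDiffOn ℝ 2 (F .L) unitSq) :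
    IsG2Gluing F (fun S => (α S).eval) fun S => (β S).eval where
  differentiableOn_a S := (α S).differentiableOn
  differentiableOn_b S := (β S).differentiableOn
  a_ne_zero S _ := hαβ.eval_alpha_ne_zero S
  edgeZero_eqOn := hαβ.edgeZero_eqOn
  edgeOne_eqOn := hαβ.edgeOne_eqOn
  edgeTwo_eqOn := hαβ.edgeTwo_eqOn hF

end IsBilinearLikeG2With

theorem gOne_eq_edgeOne (S : Side) :
    gOne F α β φ S = edgeOne (φ ∘ F S) (α S).eval (β S).eval := by
  ext v
  exact div_eq_inv_mul _ _

theorem gTwo_eq_edgeTwo (S : Side) :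
    gTwo F α β φ S = edgeTwo (φ ∘ F S) (α S).eval (β S).eval := by
  ext v
  rw [gTwo, gOne_eq_edgeOne]
  exact div_eq_inv_mul _ _

end IsogeometricFunctions

end TwoPatch

theorem lemma1 (p r k : ℕ) (hp : 5 ≤ p) (hr : 2 ≤ r) (hrp : r ≤ p - 3)
    (τ : Fin k → ℝ) (hτ : IsInnerKnots τ)
    (F : Side → ℝ × ℝ → ℝ × ℝ) (hF : IsTwoPatchParameterization p r τ F)
    (α β : Side → Polynomial ℝ) (hαβ : IsBilinearLikeG2With F α β)
    (φ : ℝ × ℝ → ℝ) (hφ : φ ∈ isogeometricSpace p r τ F) :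
    φ ∈ smoothIsogeometricSpace p r τ F 2 ↔
      (∀ v ∈ unitI, gZero F φ Side.L v = gZero F φ Side.R v) ∧
      (∀ v ∈ unitI, gOne F α β φ Side.L v = gOne F α β φ Side.R v) ∧
      (∀ v ∈ unitI, gTwo F α β φ Side.L v = gTwo F α β φ Side.R v) := by
  have hF₂ := hF.isRegularPatch hr
  simp only [gOne_eq_edgeOne, gTwo_eq_edgeTwo]
  exact (and_iff_right hφ).trans <| lemma1_general hF₂ hF.inter_eq
    (hαβ.isG2Gluing (hF₂ .L).contDiffOn) (contDiffOn_comp_of_mem_isogeometricSpace hφ hr)
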